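/- Let $S$ be a locally compact Hausdorff space, with Stone–Čech compactification $\beta S\supseteq S$. Let $\mathfrak R(S)$ be the Boolean algebra of regular open subsets of $S$ (those with $R=\mathrm{int}(\mathrm{clos}(R))$), with meet $Q\cap R$, join $Q\vee R:=\mathrm{int}(\mathrm{clos}(Q\cup R))$ and complement $\neg R:=\mathrm{int}(S\setminus R)$. For $R\in\mathfrak R(S)$ let $\widehat R$ be the unique regular open subset of $\beta S$ with $\widehat R\cap S=R$. Let $\mathfrak B$ be a Boolean subalgebra of $\mathfrak R(S)$ which is *generative*, i.e. $\{\widehat B : B\in\mathfrak B\}$ is a base for the topology of $\beta S$. Let $\mu$ be a *credence* on $\mathfrak B$: a function $\mu:\mathfrak B\to[0,1]$ with $\mu[S]=1$ and $\mu[B_1\vee\dots\vee B_N]=\sum_{n=1}^N\mu[B_n]$ for every finite family of disjoint $B_1,\dots,B_N\in\mathfrak B$. *Integration.* A function $f:S\to\mathbb R$ is *simple* if there are disjoint $P_1,\dots,P_N\in\mathfrak B$ with $P_1\vee\dots\vee P_N=S$ such that $f$ is equal to a constant $r_n$ on each $P_n$; then $\int^\diamond_D f\,d\mu:=\sum_{n=1}^N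 r_n\,\mu[P_n\cap D]$ for $D\in\mathfrak B$. Let $\mathcal G_{\mathfrak B}(S)$ be the closed linear span, in the bounded continuous functions $S\to\mathbb R$ with the uniform norm, of those bounded continuous $f$ such that $\mathrm{int}(f^{-1}(-\infty,r])\in\mathfrak B$ and $\mathrm{int}(f^{-1}[r,\infty))\in\mathfrak B$ for all $r\in\mathbb R$. For $g\in\mathcal G_{\mathfrak B}(S)$ and $D\in\mathfrak B$ let $$\mathbb I^\mu_D[g]:=\sup\Big\{\int^\diamond_D f\,d\mu \;:\; f \text{ simple},\ f(s)\le g(s)\text{ for all } s\in D\Big\}.$$ *Stone space and Gleason map.* Let $S^*:=\sigma(\mathfrak B)$ be the Stone space of $\mathfrak B$, i.e. the set of all ultrafilters of $\mathfrak B$, with the topology which has the sets $B^*:=\{s^*\in S^* : B\in s^*\}$ ($B\in\mathfrak B$) as a base. The map $B\mapsto B^*$ is an isomorphism from $\mathfrak B$ onto the algebra of clopen subsets of $S^*$; let $\mu^*[B^*]:=\mu[B]$, a probability charge on the clopen subsets of $S^*$. For $s^*\in S^*$ let $p(s^*)$ be the unique element of $\bigcap_{B\in s^*}\mathrm{clos}(\widehat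 B)$; this is the generalized Gleason map $p:S^*\to\beta S$. For bounded continuous $g:S\to\mathbb R$ let $\widehat g:\beta S\to\mathbb R$ be its continuous extension. **Theorem.** There is a unique regular (Radon) Borel probability measure on $S^*$ which extends $\mu^*$. Furthermore, if $\nu$ is any Borel probability measure on $S^*$ which extends $\mu^*$ (in particular, if $\nu$ is the regular one), then for every $g\in\mathcal G_{\mathfrak B}(S)$ and every $D\in\mathfrak B$ the function $\widehat g\circ p$ is $\nu$-integrable on $D^*$ and $$\mathbb I^\mu_D[g]=\int_{D^*}\widehat g\circ p\;d\nu .$$ -/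

import Mathlib

open TopologicalSpace MeasureTheory
open scoped BoundedContinuousFunction

noncomputable section

namespace CredenceTheory

/-! ## Stone spaces of Boolean algebras -/

/-- The Stone space of a Boolean algebra `A`: the set of all ultrafilters of `A`. -/
@[ext]
structure StoneSpace (A : Type*) [BooleanAlgebra A] where
  carrier : Set A
  inf_mem : ∀ {a b : A}, a ∈ carrier → b ∈ carrier → a ⊓ b ∈ carrier
  mem_of_le : ∀ {a b : A}, a ∈ carrier → a ≤ b → b ∈ carrier
  bot_notMem : ⊥ ∉ carrier
  mem_or_compl_mem : ∀ a : A, a ∈ carrier ∨ aᶜ ∈ carrier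

namespace StoneSpace

variable {A : Type*} [BooleanAlgebra A]

/-- The set of all ultrafilters which contain `a`. -/
def star (a : A) : Set (StoneSpace A) := {U | a ∈ U.carrier}

/-- The sets `star a` generate (and in fact are a base of) the topology of the Stone space. -/
instance : TopologicalSpace (StoneSpace A) := generateFrom (Set.range star)

/-- The Stone space carries its Borel sigma-algebra. -/
instance : MeasurableSpace (StoneSpace A) := borel _

instance : BorelSpace (StoneSpace A) := ⟨rfl⟩

theorem compl_mem_iff (U : StoneSpace A) (a : A) : aᶜ ∈ U.carrier ↔ a ∉ U.carrier := by
  constructor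
  · intro h h'
    exact U.bot_notMem (by simpa using U.inf_mem h' h)
  · intro h
    exact (U.mem_or_compl_mem a).resolve_left h

theorem inf_mem_iff (U : StoneSpace A) (a b : A) :
    a ⊓ b ∈ U.carrier ↔ a ∈ U.carrier ∧ b ∈ U.carrier :=
  ⟨fun h => ⟨U.mem_of_le h inf_le_left, U.mem_of_le h inf_le_right⟩, fun h => U.inf_mem h.1 h.2⟩

theorem top_mem (U : StoneSpace A) : ⊤ ∈ U.carrier := by
  have := (U.compl_mem_iff ⊥).2 U.bot_notMem
  simpa using this

theorem star_compl (a : A) : star aᶜ = (star a)ᶜ := Set.ext fun U => U.compl_mem_iff a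

theorem star_inf (a b : A) : star (a ⊓ b) = star a ∩ star b := Set.ext fun U => U.inf_mem_iff a b

theorem star_top : star (⊤ : A) = Set.univ := Set.eq_univ_of_forall fun U => U.top_mem

theorem star_bot : star (⊥ : A) = ∅ := Set.eq_empty_of_forall_notMem fun U => U.bot_notMem

theorem star_sup (a b : A) : star (a ⊔ b) = star a ∪ star b := by
  have : a ⊔ b = (aᶜ ⊓ bᶜ)ᶜ := by simp
  rw [this, star_compl, star_inf, star_compl, star_compl, Set.compl_inter, compl_compl, compl_compl]

theorem isOpen_star (a : A) : IsOpen (star a) := isOpen_generateFrom_of_mem ⟨a, rfl⟩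

theorem isClopen_star (a : A) : IsClopen (star a) :=
  ⟨⟨by rw [← star_compl]; exact isOpen_star _⟩, isOpen_star a⟩

theorem isTopologicalBasis_star : IsTopologicalBasis (Set.range (star (A := A))) where
  exists_subset_inter := by
    rintro _ ⟨a, rfl⟩ _ ⟨b, rfl⟩ x hx
    exact ⟨star (a ⊓ b), ⟨_, rfl⟩, by rwa [star_inf], by rw [star_inf]⟩
  sUnion_eq := Set.eq_univ_of_forall fun _ => ⟨star ⊤, ⟨⊤, rfl⟩, by rw [star_top]; trivial⟩
  eq_generateFrom := rfl

instance : CompactSpace (StoneSpace A) := by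
  refine ⟨isCompact_iff_ultrafilter_le_nhds.2 fun F _ => ?_⟩
  let U : StoneSpace A :=
    { carrier := {a | star a ∈ F}
      inf_mem := fun ha hb => Filter.mem_of_superset (Filter.inter_mem ha hb)
        fun V hV => V.inf_mem hV.1 hV.2
      mem_of_le := fun ha hab => Filter.mem_of_superset ha fun V hV => V.mem_of_le hV hab
      bot_notMem := by
        change star (⊥ : A) ∉ F
        rw [star_bot]
        exact F.empty_notMem
      mem_or_compl_mem := fun a => by
        change star a ∈ F ∨ star aᶜ ∈ F
        rw [star_compl]
        exact F.mem_or_compl_mem _ }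
  refine ⟨U, trivial, ?_⟩
  rw [nhds_generateFrom]
  refine le_iInf₂ fun s hs => ?_
  obtain ⟨hU, a, rfl⟩ := hs
  exact Filter.le_principal_iff.2 hU

/-- Every non-zero element of a Boolean algebra lies in an ultrafilter. -/
theorem exists_mem_of_ne_bot {a : A} (ha : a ≠ ⊥) : ∃ U : StoneSpace A, a ∈ U.carrier := by
  obtain ⟨J, hJ, -, hd⟩ := DistribLattice.prime_ideal_of_disjoint_filter_ideal
    (F := Order.PFilter.principal a) (I := (⊥ : Order.Ideal A)) (by
      rw [Set.disjoint_left]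
      intro x hx hx'
      have h1 : a ≤ x := Order.PFilter.mem_principal.1 hx
      have h2 : x = ⊥ := le_bot_iff.1 (show x ≤ ⊥ from hx')
      exact ha (le_bot_iff.1 (h2 ▸ h1)))
  rw [Set.disjoint_left] at hd
  refine ⟨⟨{x | x ∉ J}, ?_, ?_, ?_, ?_⟩, ?_⟩
  · intro x y hx hy hxy
    exact (hJ.mem_or_mem hxy).elim hx hy
  · intro x y hx hxy hy
    exact hx (J.lower hxy hy)
  · exact fun h => h J.bot_mem
  · intro x
    by_contra h
    simp only [Set.mem_ofPred_eq, not_or, not_not] at h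
    have h1 : x ⊔ xᶜ ∈ J := Order.Ideal.sup_mem h.1 h.2
    rw [sup_compl_eq_top] at h1
    exact hd (Order.PFilter.mem_principal.2 le_top) h1
  · exact hd (Order.PFilter.mem_principal.2 le_rfl)

theorem star_subset_star {a b : A} : star a ⊆ star b ↔ a ≤ b := by
  refine ⟨fun h => ?_, fun h U hU => U.mem_of_le hU h⟩
  by_contra hab
  have hne : a ⊓ bᶜ ≠ ⊥ := fun h0 => hab (by
    rw [← sdiff_eq] at h0
    exact sdiff_eq_bot_iff.1 h0)
  obtain ⟨U, hU⟩ := exists_mem_of_ne_bot hne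
  rw [inf_mem_iff, compl_mem_iff] at hU
  exact hU.2 (h hU.1)

theorem exists_star_eq {C : Set (StoneSpace A)} (hC : IsClopen C) : ∃ a : A, star a = C := by
  refine hC.1.isCompact.induction_on (p := fun K => ∃ a : A, K ⊆ star a ∧ star a ⊆ C)
    ⟨⊥, Set.empty_subset _, by simp [star_bot]⟩ ?_ ?_ ?_ |>.imp
    fun a ha => Set.Subset.antisymm ha.2 ha.1
  · rintro s t hst ⟨a, ha, ha'⟩
    exact ⟨a, hst.trans ha, ha'⟩
  · rintro s t ⟨a, ha, ha'⟩ ⟨b, hb, hb'⟩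
    exact ⟨a ⊔ b, by rw [star_sup]; exact Set.union_subset_union ha hb,
      by rw [star_sup]; exact Set.union_subset ha' hb'⟩
  · intro x hx
    obtain ⟨_, ⟨a, rfl⟩, hxa, haC⟩ := isTopologicalBasis_star.exists_subset_of_mem_open hx hC.2
    exact ⟨star a, mem_nhdsWithin_of_mem_nhds ((isOpen_star a).mem_nhds hxa), a, subset_rfl, haC⟩

/-- The Stone representation theorem: `a ↦ star a` is an isomorphism from `A` onto the Boolean
algebra of clopen subsets of its Stone space. -/
def representation : A ≃o Clopens (StoneSpace A) where
  toEquiv := Equiv.ofBijective (fun a => (⟨star a, isClopen_star a⟩ : Clopens (StoneSpace A)))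
    ⟨fun _ _ h => le_antisymm
        (star_subset_star.1 (congrArg (fun C : Clopens _ => (C : Set (StoneSpace A))) h).subset)
        (star_subset_star.1 (congrArg (fun C : Clopens _ => (C : Set (StoneSpace A))) h).superset),
      fun C => (exists_star_eq C.isClopen).imp fun _ h => SetLike.coe_injective h⟩
  map_rel_iff' := star_subset_star

end StoneSpace

/-! ## Regular open sets

`Heyting.Regular (Opens S)` is the Boolean algebra of regular open subsets of `S`; the next three
facts spell out its elements and its operations (the meet is the intersection). -/

section Regular

variable {S : Type*} [TopologicalSpace S]

/-- The underlying set of a regular open set. -/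
abbrev rset (R : Heyting.Regular (Opens S)) : Set S := ((R : Opens S) : Set S)

theorem isRegular_iff (U : Opens S) :
    Heyting.IsRegular U ↔ interior (closure (U : Set S)) = U := by
  rw [Heyting.IsRegular, ← SetLike.coe_set_eq]
  simp [Opens.coe_compl_eq_interior_compl, interior_compl]

theorem rset_compl (R : Heyting.Regular (Opens S)) : rset Rᶜ = interior (rset R)ᶜ := by
  simp [rset, Opens.coe_compl_eq_interior_compl]

theorem rset_sup (Q R : Heyting.Regular (Opens S)) :
    rset (Q ⊔ R) = interior (closure (rset Q ∪ rset R)) := by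
  refine ((isRegular_iff _).1 (Q ⊔ R).prop).symm.trans ?_
  change interior (closure (((((Q : Opens S) ⊔ R)ᶜᶜ : Opens S)) : Set S)) = _
  simp only [Opens.coe_compl_eq_interior_compl, Opens.coe_sup, interior_compl, compl_compl,
    interior_closure_idem]

end Regular

/-! ## Credences and integration -/

section Integration

variable {S : Type*} [TopologicalSpace S] {𝔅 : BooleanSubalgebra (Heyting.Regular (Opens S))}

/-- The underlying set of an element of a Boolean algebra of regular open sets. -/
abbrev bset (B : 𝔅) : Set S := rset (B : Heyting.Regular (Opens S))

/-- A credence: a `[0,1]`-valued function which is normalized and finitely additive with respect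
to the join `⊔` of regular open sets. -/
structure IsCredence (μ : 𝔅 → ℝ) : Prop where
  nonneg : ∀ B, 0 ≤ μ B
  le_one : ∀ B, μ B ≤ 1
  map_top : μ ⊤ = 1
  additive : ∀ (N : ℕ) (B : Fin N → 𝔅), Pairwise (fun i j => Disjoint (B i) (B j)) →
    μ (Finset.univ.sup B) = ∑ n, μ (B n)

/-- A finite family of disjoint elements of `𝔅` whose join is the whole space. -/
structure IsPartition {N : ℕ} (P : Fin N → 𝔅) : Prop where
  disjoint : Pairwise fun i j => Disjoint (P i) (P j)
  sup_eq_top : Finset.univ.sup P = ⊤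

/-- `f` takes the constant value `r n` on the cell `P n`, for every `n`. -/
def IsSubordinate (f : S → ℝ) {N : ℕ} (P : Fin N → 𝔅) (r : Fin N → ℝ) : Prop :=
  ∀ n, ∀ s ∈ bset (P n), f s = r n

/-- `f` is a `𝔅`-simple function (arbitrary outside the cells of a finite partition) and
`x = ∑ n, r n * μ (P n ⊓ D)` is its integral over `D`. -/
def HasSimpleIntegral (μ : 𝔅 → ℝ) (D : 𝔅) (f : S → ℝ) (x : ℝ) : Prop :=
  ∃ (N : ℕ) (P : Fin N → 𝔅) (r : Fin N → ℝ), IsPartition P ∧ IsSubordinate f P r ∧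
    x = ∑ n, r n * μ (P n ⊓ D)

/-- The integrals over `D` of all simple functions which are at most `g` on `D`. -/
def lowerSums (μ : 𝔅 → ℝ) (D : 𝔅) (g : S → ℝ) : Set ℝ :=
  {x | ∃ f : S → ℝ, (∀ s ∈ bset D, f s ≤ g s) ∧ HasSimpleIntegral μ D f x}

/-- The integral of `g` over `D` with respect to the credence `μ`. -/
def integrator (μ : 𝔅 → ℝ) (D : 𝔅) (g : S →ᵇ ℝ) : ℝ := sSup (lowerSums μ D g)

theorem IsCredence.sum_partition {μ : 𝔅 → ℝ} (hμ : IsCredence μ) {N : ℕ} {P : Fin N → 𝔅}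
    (hP : IsPartition P) (D : 𝔅) : ∑ n, μ (P n ⊓ D) = μ D := by
  rw [← hμ.additive N (fun n => P n ⊓ D)
    fun i j hij => (hP.disjoint hij).mono inf_le_left inf_le_left]
  congr 1
  rw [← Finset.sup_inf_distrib_right, hP.sup_eq_top, top_inf_eq]

theorem IsCredence.map_bot {μ : 𝔅 → ℝ} (hμ : IsCredence μ) : μ ⊥ = 0 := by
  simpa using hμ.additive 0 Fin.elim0 (fun i => i.elim0)

theorem bset_nonempty {B : 𝔅} (h : B ≠ ⊥) : (bset B).Nonempty := by
  rw [Set.nonempty_iff_ne_empty]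
  intro h0
  exact h (Subtype.ext (Subtype.ext (SetLike.coe_injective h0)))

/-- The integral of a simple function does not depend on the partition used to compute it. -/
theorem HasSimpleIntegral.unique {μ : 𝔅 → ℝ} (hμ : IsCredence μ) {D : 𝔅} {f : S → ℝ} {x y : ℝ}
    (hx : HasSimpleIntegral μ D f x) (hy : HasSimpleIntegral μ D f y) : x = y := by
  obtain ⟨N, P, r, hP, hr, rfl⟩ := hx
  obtain ⟨M, Q, q, hQ, hq, rfl⟩ := hy
  have h1 : ∀ n, μ (P n ⊓ D) = ∑ m, μ (Q m ⊓ (P n ⊓ D)) :=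
    fun n => (hμ.sum_partition hQ _).symm
  have h2 : ∀ m, μ (Q m ⊓ D) = ∑ n, μ (Q m ⊓ (P n ⊓ D)) := by
    intro m
    rw [← hμ.sum_partition hP]
    exact Finset.sum_congr rfl fun n _ => by rw [inf_left_comm]
  simp_rw [h1, h2, Finset.mul_sum]
  rw [Finset.sum_comm]
  refine Finset.sum_congr rfl fun m _ => Finset.sum_congr rfl fun n _ => ?_
  by_cases h : Q m ⊓ (P n ⊓ D) = ⊥
  · rw [h, hμ.map_bot, mul_zero, mul_zero]
  · obtain ⟨s, hs⟩ := bset_nonempty h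
    have hs' : s ∈ bset (Q m) ∧ s ∈ bset (P n) := ⟨hs.1, hs.2.1⟩
    rw [← hr n s hs'.2, ← hq m s hs'.1]

/-- The supremum which defines the integral is a genuine one. -/
theorem isLUB_integrator {μ : 𝔅 → ℝ} (hμ : IsCredence μ) (D : 𝔅) (g : S →ᵇ ℝ) :
    IsLUB (lowerSums μ D g) (integrator μ D g) := by
  refine isLUB_csSup ?_ ⟨‖g‖ * μ D, ?_⟩
  · refine ⟨_, fun _ => -‖g‖, fun s _ => (abs_le.1 (g.norm_coe_le_norm s)).1, 1, fun _ => ⊤,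
      fun _ => -‖g‖, ⟨fun i j hij => (hij (Subsingleton.elim i j)).elim, by simp⟩,
      fun _ _ _ => rfl, rfl⟩
  · rintro _ ⟨f, hf, N, P, r, hP, hr, rfl⟩
    rw [← hμ.sum_partition hP, Finset.mul_sum]
    refine Finset.sum_le_sum fun n _ => ?_
    by_cases h : P n ⊓ D = ⊥
    · rw [h, hμ.map_bot, mul_zero, mul_zero]
    · obtain ⟨s, hs⟩ := bset_nonempty h
      have hs' : s ∈ bset (P n) ∧ s ∈ bset D := hs
      refine mul_le_mul_of_nonneg_right ?_ (hμ.nonneg _)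
      rw [← hr n s hs'.1]
      exact (hf s hs'.2).trans (abs_le.1 (g.norm_coe_le_norm s)).2

variable (𝔅) in
/-- `f` is `𝔅`-comeasurable: the interiors of the preimages of all closed half-lines are in `𝔅`.
(For continuous `f`, closed half-lines can be replaced by closures of finite unions of
intervals.) -/
def IsComeasurable (f : S → ℝ) : Prop :=
  ∀ r : ℝ, (∃ B : 𝔅, bset B = interior (f ⁻¹' Set.Iic r)) ∧
    ∃ B : 𝔅, bset B = interior (f ⁻¹' Set.Ici r)

variable (𝔅) in
/-- The closed linear span (for the uniform norm) of the bounded continuous `𝔅`-comeasurable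
functions. -/
def integrands : Submodule ℝ (S →ᵇ ℝ) :=
  (Submodule.span ℝ {f : S →ᵇ ℝ | IsComeasurable 𝔅 f}).topologicalClosure

/-- The charge on the clopen subsets of the Stone space of `𝔅` that corresponds to `μ` under the
Stone representation: it sends the clopen set of all ultrafilters containing `B` to `μ B`. -/
def stoneCharge (μ : 𝔅 → ℝ) (C : Clopens (StoneSpace 𝔅)) : ℝ :=
  μ (StoneSpace.representation.symm C)

end Integration

/-! ## The Stone–Čech compactification and the generalized Gleason map -/

section Gleason

variable {S : Type*} [TopologicalSpace S]

theorem mem_closedBall_norm (g : S →ᵇ ℝ) (s : S) : g s ∈ Metric.closedBall (0 : ℝ) ‖g‖ := by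
  rw [mem_closedBall_zero_iff]
  exact g.norm_coe_le_norm s

/-- The continuous extension to the Stone–Čech compactification of a bounded continuous function,
seen as a map into a compact ball. -/
def stoneCechExtension (g : S →ᵇ ℝ) (x : StoneCech S) : ℝ :=
  (stoneCechExtend (g.continuous.subtype_mk (mem_closedBall_norm g)) x :
    Metric.closedBall (0 : ℝ) ‖g‖)

theorem continuous_stoneCechExtension (g : S →ᵇ ℝ) : Continuous (stoneCechExtension g) :=
  continuous_subtype_val.comp
    (continuous_stoneCechExtend (g.continuous.subtype_mk (mem_closedBall_norm g)))

theorem stoneCechExtension_stoneCechUnit (g : S →ᵇ ℝ) (s : S) :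
    stoneCechExtension g (stoneCechUnit s) = g s := by
  simp [stoneCechExtension, stoneCechExtend_stoneCechUnit]


/-- Every open subset of the Stone–Čech compactification has the same closure as its trace. -/
theorem closure_image_preimage {U : Set (StoneCech S)} (hU : IsOpen U) :
    closure (stoneCechUnit '' (stoneCechUnit ⁻¹' U : Set S)) = closure U := by
  rw [Set.image_preimage_eq_inter_range]
  exact Set.Subset.antisymm (closure_mono Set.inter_subset_left)
    (closure_minimal (denseRange_stoneCechUnit.open_subset_closure_inter hU) isClosed_closure)

variable [T2Space S] [LocallyCompactSpace S]

theorem isOpenEmbedding_stoneCechUnit :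
    Topology.IsOpenEmbedding (stoneCechUnit : S → StoneCech S) := by
  have : CompletelyRegularSpace S :=
    OnePoint.isOpenEmbedding_coe.isInducing.completelyRegularSpace
  have : T35Space S := {}
  have hemb : Topology.IsEmbedding (stoneCechUnit : S → StoneCech S) := isEmbedding_stoneCechUnit
  refine ⟨hemb, isOpen_iff_mem_nhds.2 ?_⟩
  rintro _ ⟨x, rfl⟩
  obtain ⟨K, hK, hxK⟩ := exists_compact_mem_nhds x
  rw [hemb.nhds_eq_comap, Filter.mem_comap] at hxK
  obtain ⟨V, hV, hVK⟩ := hxK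
  obtain ⟨U, hUV, hU, hxU⟩ := mem_nhds_iff.1 hV
  refine Filter.mem_of_superset (hU.mem_nhds hxU) ?_
  have h1 : U ⊆ closure (U ∩ Set.range stoneCechUnit) :=
    denseRange_stoneCechUnit.open_subset_closure_inter hU
  have h2 : U ∩ Set.range stoneCechUnit ⊆ stoneCechUnit '' K := by
    rintro _ ⟨hy, y, rfl⟩
    exact ⟨y, hVK (hUV hy), rfl⟩
  have h3 : IsClosed (stoneCechUnit '' K : Set (StoneCech S)) :=
    (hK.image continuous_stoneCechUnit).isClosed
  exact (h1.trans (closure_minimal h2 h3)).trans (Set.image_subset_range _ _)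

/-- A regular open set `R` is the trace of a unique regular open subset of the Stone–Čech
compactification. -/
theorem existsUnique_extension (R : Heyting.Regular (Opens S)) :
    ∃! Q : Heyting.Regular (Opens (StoneCech S)), stoneCechUnit ⁻¹' rset Q = rset R := by
  have hι := isOpenEmbedding_stoneCechUnit (S := S)
  refine ⟨⟨⟨interior (closure (stoneCechUnit '' rset R)), isOpen_interior⟩, ?_⟩, ?_, ?_⟩
  · rw [isRegular_iff]
    exact interior_closure_idem
  · change stoneCechUnit ⁻¹' interior (closure (stoneCechUnit '' rset R)) = rset R
    rw [hι.isOpenMap.preimage_interior_eq_interior_preimage hι.continuous,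
      hι.isOpenMap.preimage_closure_eq_closure_preimage hι.continuous,
      Set.preimage_image_eq _ hι.injective]
    exact (isRegular_iff _).1 R.prop
  · intro Q hQ
    apply Subtype.ext
    apply SetLike.coe_injective
    change rset Q = interior (closure (stoneCechUnit '' rset R))
    rw [← hQ, closure_image_preimage (Q : Opens (StoneCech S)).isOpen]
    exact ((isRegular_iff _).1 Q.prop).symm

/-- The unique regular open subset of the Stone–Čech compactification with trace `R`. -/
def hat (R : Heyting.Regular (Opens S)) : Heyting.Regular (Opens (StoneCech S)) :=
  (existsUnique_extension R).choose

theorem preimage_hat (R : Heyting.Regular (Opens S)) : stoneCechUnit ⁻¹' rset (hat R) = rset R :=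
  (existsUnique_extension R).choose_spec.1

theorem closure_hat (R : Heyting.Regular (Opens S)) :
    closure (rset (hat R)) = closure (stoneCechUnit '' rset R) := by
  rw [← closure_image_preimage (hat R : Opens (StoneCech S)).isOpen, preimage_hat]

variable {𝔅 : BooleanSubalgebra (Heyting.Regular (Opens S))}

variable (𝔅) in
/-- `𝔅` is generative: the extensions of its elements are a base for the topology of the
Stone–Čech compactification. -/
def IsGenerative : Prop := IsTopologicalBasis {U : Set (StoneCech S) | ∃ B : 𝔅, U = rset (hat B.1)}

/-- For an ultrafilter in a generative algebra, the closures of the extensions of its elements have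
exactly one common point. -/
theorem IsGenerative.existsUnique (h𝔅 : IsGenerative 𝔅) (s : StoneSpace 𝔅) :
    ∃! x : StoneCech S, x ∈ ⋂ B ∈ s.carrier, closure (rset (hat (B : Heyting.Regular (Opens S)))) := by
  have hne : (⋂ B : s.carrier, closure (rset (hat B.1.1))).Nonempty := by
    have : Nonempty s.carrier := ⟨⟨⊤, s.top_mem⟩⟩
    refine IsCompact.nonempty_iInter_of_directed_nonempty_isCompact_isClosed _ ?_ ?_
      (fun _ => isClosed_closure.isCompact) (fun _ => isClosed_closure)
    · rintro ⟨B, hB⟩ ⟨C, hC⟩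
      refine ⟨⟨B ⊓ C, s.inf_mem hB hC⟩, ?_, ?_⟩
      · change closure _ ⊆ closure _
        rw [closure_hat, closure_hat]
        exact closure_mono (Set.image_mono fun x hx => hx.1)
      · change closure _ ⊆ closure _
        rw [closure_hat, closure_hat]
        exact closure_mono (Set.image_mono fun x hx => hx.2)
    · rintro ⟨B, hB⟩
      have : B ≠ ⊥ := fun h => s.bot_notMem (h ▸ hB)
      rw [closure_hat]
      exact ((bset_nonempty this).image _).closure
  obtain ⟨x, hx⟩ := hne
  rw [Set.mem_iInter] at hx
  refine ⟨x, Set.mem_iInter₂.2 fun B hB => hx ⟨B, hB⟩, fun y hy => ?_⟩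
  replace hy := Set.mem_iInter₂.1 hy
  by_contra hyx
  obtain ⟨U, V, hU, hV, hxU, hyV, hUV⟩ := t2_separation (Ne.symm hyx)
  obtain ⟨_, ⟨B, rfl⟩, hxB, hBU⟩ := h𝔅.exists_subset_of_mem_open hxU hU
  rcases s.mem_or_compl_mem B with hB | hB
  · exact (hUV.mono_left hBU).closure_left hV |>.le_bot ⟨hy B hB, hyV⟩
  · have h1 := hx ⟨Bᶜ, hB⟩
    rw [closure_hat, mem_closure_iff] at h1
    obtain ⟨_, hz, z, hzB, rfl⟩ := h1 _ (hat B.1 : Opens (StoneCech S)).isOpen hxB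
    have hz' : z ∈ rset B.1 := by rw [← preimage_hat]; exact hz
    have hzB' : z ∈ rset (B.1)ᶜ := hzB
    rw [rset_compl] at hzB'
    exact interior_subset hzB' hz'

/-- The generalized Gleason map, which sends an ultrafilter `s` to the unique common point of the
closures of the extensions of the elements of `s`. -/
def gleasonMap (h𝔅 : IsGenerative 𝔅) (s : StoneSpace 𝔅) : StoneCech S :=
  (h𝔅.existsUnique s).choose

theorem iInter_closure_hat (h𝔅 : IsGenerative 𝔅) (s : StoneSpace 𝔅) :
    ⋂ B ∈ s.carrier, closure (rset (hat (B : Heyting.Regular (Opens S)))) = {gleasonMap h𝔅 s} :=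
  Set.eq_singleton_iff_unique_mem.2 (h𝔅.existsUnique s).choose_spec

end Gleason

end CredenceTheory

end

open CredenceTheory

/-!
For a continuous function `h` on a profinite space, the lower sums over clopen partitions converge
to the integral of `h`, against any measure whose values on clopen sets are the prescribed ones. The
Gleason map sends `star B` onto the closure of `hat B`, which is also the closure of `B` itself;
hence a constant is at most `g` on `B` iff it is at most the lift of `g` on `star B`, so the lower
sums which define the integral of `g` are those of the continuous lift. For the regular measure, the
charge of a compact set is the infimum of the charges of the clopen sets around it: clopen sets
separate disjoint compact sets, so this is a content, and regularity leaves no other choice.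
-/

namespace CredenceTheory

open Function Topology
open scoped NNReal

section DisjointAdditive

variable {A M : Type*} [GeneralizedBooleanAlgebra A] [AddCommMonoid M] [Preorder M]
  [CanonicallyOrderedAdd M] {m : A → M}

theorem monotone_of_map_sup_of_disjoint (hm : ∀ a b, Disjoint a b → m (a ⊔ b) = m a + m b) :
    Monotone m := fun a b hab => by
  rw [← sup_sdiff_cancel_right hab, hm _ _ disjoint_sdiff_self_right]
  exact le_self_add

theorem map_sup_le_add_of_map_sup_of_disjoint [AddLeftMono M]
    (hm : ∀ a b, Disjoint a b → m (a ⊔ b) = m a + m b) (a b : A) : m (a ⊔ b) ≤ m a + m b := by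
  rw [← sup_sdiff_self_right, hm _ _ disjoint_sdiff_self_right]
  gcongr
  exact monotone_of_map_sup_of_disjoint hm sdiff_le

end DisjointAdditive

section OuterCharge

variable {X : Type*} [TopologicalSpace X] {m : Clopens X → ℝ≥0}

/-- The infimum of the charges of the clopen sets that contain `K`. For compact `K` in a profinite
space, it is the measure of `K` for the regular extension of the charge `m`. -/
noncomputable def outerCharge (m : Clopens X → ℝ≥0) (K : Set X) : ℝ≥0 :=
  ⨅ C : {C : Clopens X // K ⊆ C}, m C

instance (K : Set X) : Nonempty {C : Clopens X // K ⊆ C} := ⟨⟨⊤, Set.subset_univ K⟩⟩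

theorem outerCharge_le {K : Set X} {C : Clopens X} (hC : K ⊆ C) : outerCharge m K ≤ m C :=
  ciInf_le (f := fun C : {C : Clopens X // K ⊆ C} => m C) (OrderBot.bddBelow _) ⟨C, hC⟩

theorem le_outerCharge {K : Set X} {x : ℝ≥0} (h : ∀ C : Clopens X, K ⊆ C → x ≤ m C) :
    x ≤ outerCharge m K :=
  le_ciInf fun C => h C C.2

theorem outerCharge_mono {K L : Set X} (h : K ⊆ L) : outerCharge m K ≤ outerCharge m L :=
  le_outerCharge fun _ hC => outerCharge_le (h.trans hC)

variable (hm : ∀ C D, Disjoint C D → m (C ⊔ D) = m C + m D)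
include hm

theorem outerCharge_clopens (C : Clopens X) : outerCharge m C = m C :=
  le_antisymm (outerCharge_le subset_rfl)
    (le_outerCharge fun _ hCD => monotone_of_map_sup_of_disjoint hm hCD)

theorem outerCharge_union_le (K L : Set X) :
    outerCharge m (K ∪ L) ≤ outerCharge m K + outerCharge m L :=
  NNReal.le_iInf_add_iInf fun C D =>
    (outerCharge_le (C := C.1 ⊔ D.1) (Set.union_subset_union C.2 D.2)).trans
      (map_sup_le_add_of_map_sup_of_disjoint hm C.1 D.1)

variable [CompactSpace X] [T2Space X] [TotallyDisconnectedSpace X]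

theorem outerCharge_union_of_disjoint {K L : Set X} (hK : IsClosed K) (hL : IsClosed L)
    (hKL : Disjoint K L) : outerCharge m (K ∪ L) = outerCharge m K + outerCharge m L := by
  refine le_antisymm (outerCharge_union_le hm K L) (le_outerCharge fun C hC => ?_)
  obtain ⟨U, hU, hKU, hUL⟩ :=
    exists_clopen_of_closed_subset_open hK hL.isOpen_compl hKL.subset_compl_right
  let D : Clopens X := ⟨U, hU⟩
  have hKC : K ⊆ (C ⊓ D : Clopens X) :=
    Set.subset_inter (Set.subset_union_left.trans hC) hKU
  have hLC : L ⊆ (C \ D : Clopens X) :=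
    Set.subset_inter (Set.subset_union_right.trans hC) (Set.subset_compl_comm.1 hUL)
  calc outerCharge m K + outerCharge m L ≤ m (C ⊓ D) + m (C \ D) :=
        add_le_add (outerCharge_le hKC) (outerCharge_le hLC)
    _ = m C := by rw [← hm _ _ disjoint_inf_sdiff, sup_inf_sdiff]

omit hm in
/-- The content whose value on compact sets is the outer charge of an additive function `m` of
clopen sets. -/
noncomputable def clopenContent (hm : ∀ C D, Disjoint C D → m (C ⊔ D) = m C + m D) :
    Content X where
  toFun K := outerCharge m K
  mono' _ _ h := outerCharge_mono h
  sup_disjoint' _ _ hKL hK hL := outerCharge_union_of_disjoint hm hK hL hKL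
  sup_le' K L := outerCharge_union_le hm K L

variable [MeasurableSpace X] [BorelSpace X]

theorem clopenContent_measure_clopens (C : Clopens X) : (clopenContent hm).measure C = m C := by
  rw [Content.measure_apply _ C.isClopen.isOpen.measurableSet,
    Content.outerMeasure_of_isOpen _ _ C.isClopen.isOpen,
    Content.innerContent_of_isCompact _ C.isClopen.isClosed.isCompact]
  exact congrArg _ (outerCharge_clopens hm C)

end OuterCharge

section Profinite

variable {X : Type*} [TopologicalSpace X] [CompactSpace X] [T2Space X] [TotallyDisconnectedSpace X]

section Measure

variable [MeasurableSpace X]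

theorem measure_le_of_isOpen_of_forall_clopens {ν ρ : Measure X} [ν.Regular]
    (h : ∀ C : Clopens X, ν C ≤ ρ C) {W : Set X} (hW : IsOpen W) : ν W ≤ ρ W := by
  rw [hW.measure_eq_iSup_isCompact]
  refine iSup₂_le fun K hKW => iSup_le fun hK => ?_
  obtain ⟨C, hC, hKC, hCW⟩ := exists_clopen_of_closed_subset_open hK.isClosed hW hKW
  exact (measure_mono hKC).trans ((h ⟨C, hC⟩).trans (measure_mono hCW))

theorem measure_ext_of_clopens {ν ρ : Measure X} [ν.Regular] [ρ.Regular]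
    (h : ∀ C : Clopens X, ν C = ρ C) : ν = ρ :=
  Measure.OuterRegular.ext_isOpen fun _ hW =>
    le_antisymm (measure_le_of_isOpen_of_forall_clopens (fun C => (h C).le) hW)
      (measure_le_of_isOpen_of_forall_clopens (fun C => (h C).ge) hW)

variable [BorelSpace X]

theorem existsUnique_regular_measure_of_clopens {m : Clopens X → ℝ≥0}
    (hm : ∀ C D, Disjoint C D → m (C ⊔ D) = m C + m D) :
    ∃! ν : Measure X, ν.Regular ∧ ∀ C : Clopens X, ν C = m C := by
  refine ⟨(clopenContent hm).measure, ⟨inferInstance, clopenContent_measure_clopens hm⟩, ?_⟩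
  rintro ρ ⟨hρ, hρm⟩
  exact measure_ext_of_clopens fun C => by rw [hρm, clopenContent_measure_clopens]

end Measure

theorem exists_clopen_partition_mem_Icc {h : X → ℝ} (hh : Continuous h) {ε : ℝ} (hε : 0 < ε) :
    ∃ (N : ℕ) (C : Fin N → Clopens X) (r : Fin N → ℝ), Pairwise (Disjoint on C) ∧
      Finset.univ.sup C = ⊤ ∧ ∀ n, ∀ x ∈ C n, h x ∈ Set.Icc (r n) (r n + ε) := by
  have hnear : {p : ℝ × ℝ | dist p.1 p.2 < ε / 2} ∈ 𝓝ˢ (Set.diagonal ℝ) :=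
    nhdsSet_diagonal_le_uniformity (Metric.dist_mem_uniformity (half_pos hε))
  obtain ⟨N, C, hne, hosc, hcover, hdisj⟩ :=
    ContinuousMap.exists_disjoint_nonempty_clopen_cover_of_mem_nhds_diagonal ⟨h, hh⟩ hnear
  have hpoint : ∀ n, ∃ x, x ∈ C n := fun n =>
    Set.nonempty_iff_ne_empty.2 fun hempty => hne n (SetLike.coe_injective hempty)
  choose x hx using hpoint
  refine ⟨N, C, fun n => h (x n) - ε / 2, hdisj, ?_, fun n y hy => ?_⟩
  · refine SetLike.coe_injective (Set.eq_univ_of_univ_subset ?_)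
    simpa using hcover
  · have hyx : |h y - h (x n)| < ε / 2 := hosc n y hy (x n) (hx n)
    constructor <;> linarith [abs_lt.1 hyx]

end Profinite

namespace StoneSpace

variable {A : Type*} [BooleanAlgebra A]

theorem exists_mem_notMem_of_ne {U V : StoneSpace A} (hUV : U ≠ V) :
    ∃ a, a ∈ U.carrier ∧ a ∉ V.carrier := by
  by_contra! hle
  refine hUV (StoneSpace.ext (Set.Subset.antisymm hle fun a haV => ?_))
  by_contra haU
  exact (V.compl_mem_iff a).1 (hle _ ((U.compl_mem_iff a).2 haU)) haV

instance : TotallySeparatedSpace (StoneSpace A) :=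
  totallySeparatedSpace_iff_exists_isClopen.2 fun _ _ hUV =>
    let ⟨a, haU, haV⟩ := exists_mem_notMem_of_ne hUV
    ⟨star a, isClopen_star a, haU, haV⟩

theorem measurableSet_star (a : A) : MeasurableSet (star a) := (isOpen_star a).measurableSet

theorem disjoint_star {a b : A} (h : Disjoint a b) : Disjoint (star a) (star b) := by
  rw [Set.disjoint_iff_inter_eq_empty, ← star_inf, h.eq_bot, star_bot]

theorem star_finset_sup {ι : Type*} (t : Finset ι) (f : ι → A) :
    star (t.sup f) = ⋃ i ∈ t, star (f i) :=
  (congrArg _ (map_finset_sup representation t f)).trans (Clopens.coe_finset_sup ..)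

theorem star_representation_symm (C : Clopens (StoneSpace A)) :
    star (representation.symm C) = C :=
  congrArg (fun D : Clopens (StoneSpace A) => (D : Set (StoneSpace A)))
    (representation.apply_symm_apply C)

theorem setIntegral_star_eq_sum {ι E : Type*} [Fintype ι] [NormedAddCommGroup E] [NormedSpace ℝ E]
    {P : ι → A} (hdisj : Pairwise (Disjoint on P)) (hsup : Finset.univ.sup P = ⊤) {a : A}
    {ν : Measure (StoneSpace A)} {h : StoneSpace A → E} (hh : IntegrableOn h (star a) ν) :
    ∫ t in star a, h t ∂ν = ∑ i, ∫ t in star (P i ⊓ a), h t ∂ν := by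
  have hcover : ⋃ i, star (P i ⊓ a) = star a := by
    have hstar := star_finset_sup Finset.univ fun i => P i ⊓ a
    rw [← Finset.sup_inf_distrib_right, hsup, top_inf_eq] at hstar
    simpa using hstar.symm
  rw [← integral_iUnion_fintype (fun i => measurableSet_star _)
    (fun i j hij => disjoint_star ((hdisj hij).mono inf_le_left inf_le_left))
    (fun i => hh.mono_set (star_subset_star.2 inf_le_right)), hcover]

end StoneSpace

section Credence

open StoneSpace

variable {S : Type*} [TopologicalSpace S] {𝔅 : BooleanSubalgebra (Heyting.Regular (Opens S))}
  {μ : 𝔅 → ℝ}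

theorem stoneCharge_representation (μ : 𝔅 → ℝ) (B : 𝔅) :
    stoneCharge μ (representation B) = μ B :=
  congrArg μ (representation.symm_apply_apply B)

theorem IsCredence.map_sup_of_disjoint (hμ : IsCredence μ) {B C : 𝔅} (h : Disjoint B C) :
    μ (B ⊔ C) = μ B + μ C := by
  have hpair : Pairwise fun i j => Disjoint (![B, C] i) (![B, C] j) := by
    simp [Pairwise, Fin.forall_fin_two, h, h.symm]
  simpa [Fin.univ_succ] using hμ.additive 2 ![B, C] hpair

theorem IsCredence.stoneCharge_sup_of_disjoint (hμ : IsCredence μ) {C D : Clopens (StoneSpace 𝔅)}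
    (h : Disjoint C D) : stoneCharge μ (C ⊔ D) = stoneCharge μ C + stoneCharge μ D := by
  rw [stoneCharge, map_sup, hμ.map_sup_of_disjoint (h.map_orderIso representation.symm)]
  rfl

theorem IsCredence.existsUnique_regular_extension (hμ : IsCredence μ) :
    ∃! ν : Measure (StoneSpace 𝔅), IsProbabilityMeasure ν ∧ ν.Regular ∧
      ∀ C : Clopens (StoneSpace 𝔅), ν.real (C : Set (StoneSpace 𝔅)) = stoneCharge μ C := by
  have hnonneg : ∀ C, 0 ≤ stoneCharge μ C := fun C => hμ.nonneg _
  have htop : stoneCharge μ ⊤ = 1 := by rw [stoneCharge, OrderIso.map_top, hμ.map_top]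
  have hadd : ∀ C D, Disjoint C D → (stoneCharge μ (C ⊔ D)).toNNReal =
      (stoneCharge μ C).toNNReal + (stoneCharge μ D).toNNReal := fun C D h => by
    rw [hμ.stoneCharge_sup_of_disjoint h, Real.toNNReal_add (hnonneg C) (hnonneg D)]
  refine (existsUnique_congr fun ν => ⟨?_, ?_⟩).1
    (existsUnique_regular_measure_of_clopens (m := fun C => (stoneCharge μ C).toNNReal) hadd)
  · rintro ⟨hreg, hν⟩
    have hprob : ν Set.univ = 1 := by simpa [htop] using hν ⊤
    exact ⟨⟨hprob⟩, hreg, fun C => by simp [Measure.real, hν, hnonneg]⟩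
  · rintro ⟨hprob, hreg, hν⟩
    exact ⟨hreg, fun C => by rw [← ofReal_measureReal, hν]; rfl⟩

theorem exists_isPartition_mem_Icc {h : StoneSpace 𝔅 → ℝ} (hh : Continuous h) {ε : ℝ}
    (hε : 0 < ε) : ∃ (N : ℕ) (P : Fin N → 𝔅) (r : Fin N → ℝ), IsPartition P ∧
      ∀ n, ∀ t ∈ star (P n), h t ∈ Set.Icc (r n) (r n + ε) := by
  obtain ⟨N, C, r, hdisj, hsup, hr⟩ := exists_clopen_partition_mem_Icc hh hε
  refine ⟨N, fun n => representation.symm (C n), r,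
    ⟨fun i j hij => (hdisj hij).map_orderIso _, ?_⟩, fun n t ht => hr n t ?_⟩
  · exact (map_finset_sup representation.symm Finset.univ C).symm.trans (by rw [hsup, map_top])
  · rwa [star_representation_symm] at ht

/-- Only the cells of the partition matter for a lower sum: off the cells a simple function is
arbitrary, so it can be made equal to `g` there. -/
theorem mem_lowerSums_iff {D : 𝔅} {g : S → ℝ} {x : ℝ} :
    x ∈ lowerSums μ D g ↔ ∃ (N : ℕ) (P : Fin N → 𝔅) (r : Fin N → ℝ), IsPartition P ∧
      (∀ n, ∀ s ∈ bset (P n ⊓ D), r n ≤ g s) ∧ x = ∑ n, r n * μ (P n ⊓ D) := by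
  constructor
  · rintro ⟨f, hfg, N, P, r, hP, hr, rfl⟩
    exact ⟨N, P, r, hP, fun n s hs => (hr n s hs.1).ge.trans (hfg s hs.2), rfl⟩
  · rintro ⟨N, P, r, hP, hr, rfl⟩
    let f : S → ℝ := fun s => g s + ∑ n, (bset (P n)).indicator (fun s => r n - g s) s
    have hfg : ∀ s ∈ bset D, f s ≤ g s := fun s hsD =>
      add_le_of_nonpos_right <| Finset.sum_nonpos fun n _ =>
        Set.indicator_apply_le' (fun hsP => sub_nonpos.2 (hr n s ⟨hsP, hsD⟩)) fun _ => le_rfl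
    have hf : IsSubordinate f P r := fun n s hs => by
      have hother : ∀ k ≠ n, s ∉ bset (P k) := fun k hkn hsk => by
        have hmem : s ∈ bset (P k ⊓ P n) := ⟨hsk, hs⟩
        rwa [(hP.disjoint hkn).eq_bot] at hmem
      simp only [f]
      rw [Finset.sum_eq_single_of_mem n (Finset.mem_univ n) fun k _ hkn =>
        Set.indicator_of_notMem (hother k hkn) _, Set.indicator_of_mem hs, add_sub_cancel]
    exact ⟨f, hfg, N, P, r, hP, hf, rfl⟩

end Credence

section Gleason

open StoneSpace

variable {S : Type*} [TopologicalSpace S] [T2Space S] [LocallyCompactSpace S]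

theorem disjoint_hat_closure_hat {Q R : Heyting.Regular (Opens S)} (h : Disjoint Q R) :
    Disjoint (rset (hat Q)) (closure (rset (hat R))) := by
  have hQ : IsOpen (rset (hat Q)) := (hat Q).1.isOpen
  have hR : IsOpen (rset (hat R)) := (hat R).1.isOpen
  refine Disjoint.closure_right (Set.disjoint_iff_inter_eq_empty.2 ?_) hQ
  by_contra hne
  obtain ⟨s, hs⟩ :=
    denseRange_stoneCechUnit.exists_mem_open (hQ.inter hR) (Set.nonempty_iff_ne_empty.2 hne)
  have hsQR : s ∈ rset (Q ⊓ R) :=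
    ⟨(preimage_hat Q).subset hs.1, (preimage_hat R).subset hs.2⟩
  exact h.le_bot hsQR

variable {𝔅 : BooleanSubalgebra (Heyting.Regular (Opens S))} (h𝔅 : IsGenerative 𝔅)
include h𝔅

theorem IsGenerative.exists_closure_hat_subset {x : StoneCech S} {V : Set (StoneCech S)}
    (hV : V ∈ 𝓝 x) : ∃ B : 𝔅, x ∈ rset (hat B.1) ∧ closure (rset (hat B.1)) ⊆ V := by
  obtain ⟨_, ⟨hx, B, rfl⟩, hBV⟩ := (h𝔅.nhds_basis_closure x).mem_iff.1 hV
  exact ⟨B, hx, hBV⟩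

theorem gleasonMap_mem_closure_hat {t : StoneSpace 𝔅} {B : 𝔅} (hB : t ∈ star B) :
    gleasonMap h𝔅 t ∈ closure (rset (hat B.1)) :=
  Set.mem_iInter₂.1 ((iInter_closure_hat h𝔅 t).superset (Set.mem_singleton _)) B hB

theorem mem_star_of_gleasonMap_mem_hat {t : StoneSpace 𝔅} {B : 𝔅}
    (ht : gleasonMap h𝔅 t ∈ rset (hat B.1)) : t ∈ star B := by
  by_contra htB
  have hcompl : gleasonMap h𝔅 t ∈ closure (rset (hat B.1ᶜ)) :=
    gleasonMap_mem_closure_hat h𝔅 (B := Bᶜ) ((t.compl_mem_iff B).2 htB)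
  exact (disjoint_hat_closure_hat disjoint_compl_right).notMem_of_mem_left ht hcompl

theorem continuous_gleasonMap : Continuous (gleasonMap h𝔅) := by
  refine continuous_iff_continuousAt.2 fun t V hV => ?_
  obtain ⟨B, htB, hBV⟩ := h𝔅.exists_closure_hat_subset hV
  exact Filter.mem_map.2 <| Filter.mem_of_superset
    ((isOpen_star B).mem_nhds (mem_star_of_gleasonMap_mem_hat h𝔅 htB)) fun u hu =>
      hBV (gleasonMap_mem_closure_hat h𝔅 hu)

theorem image_gleasonMap_star (B : 𝔅) :
    gleasonMap h𝔅 '' star B = closure (rset (hat B.1)) := by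
  have hclosed : IsClosed (gleasonMap h𝔅 '' star B) :=
    ((isClopen_star B).isClosed.isCompact.image (continuous_gleasonMap h𝔅)).isClosed
  refine Set.Subset.antisymm
    (Set.image_subset_iff.2 fun t ht => gleasonMap_mem_closure_hat h𝔅 ht)
    (closure_minimal (fun x hxB => ?_) hclosed)
  by_contra hx
  obtain ⟨C, hxC, hC⟩ := h𝔅.exists_closure_hat_subset (hclosed.isOpen_compl.mem_nhds hx)
  have hne : C ⊓ B ≠ ⊥ := fun hbot =>
    (disjoint_hat_closure_hat (disjoint_iff.2 (congrArg Subtype.val hbot))).notMem_of_mem_left hxC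
      (subset_closure hxB)
  obtain ⟨t, ht⟩ := exists_mem_of_ne_bot hne
  obtain ⟨htC, htB⟩ := (t.inf_mem_iff C B).1 ht
  exact hC (gleasonMap_mem_closure_hat h𝔅 htC) (Set.mem_image_of_mem _ htB)

theorem continuous_stoneCechExtension_gleasonMap (g : S →ᵇ ℝ) :
    Continuous fun t => stoneCechExtension g (gleasonMap h𝔅 t) :=
  (continuous_stoneCechExtension g).comp (continuous_gleasonMap h𝔅)

theorem integrable_stoneCechExtension_gleasonMap (ν : Measure (StoneSpace 𝔅)) [IsFiniteMeasure ν]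
    (g : S →ᵇ ℝ) : Integrable (fun t => stoneCechExtension g (gleasonMap h𝔅 t)) ν :=
  (BoundedContinuousFunction.mkOfCompact
    ⟨_, continuous_stoneCechExtension_gleasonMap h𝔅 g⟩).integrable ν

theorem forall_star_le_stoneCechExtension_gleasonMap_iff {g : S →ᵇ ℝ} {B : 𝔅} {r : ℝ} :
    (∀ t ∈ star B, r ≤ stoneCechExtension g (gleasonMap h𝔅 t)) ↔ ∀ s ∈ bset B, r ≤ g s := by
  have hclosed : IsClosed {x | r ≤ stoneCechExtension g x} :=
    isClosed_le continuous_const (continuous_stoneCechExtension g)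
  calc (∀ t ∈ star B, r ≤ stoneCechExtension g (gleasonMap h𝔅 t))
      ↔ ∀ x ∈ gleasonMap h𝔅 '' star B, r ≤ stoneCechExtension g x :=
        (Set.forall_mem_image (p := fun x => r ≤ stoneCechExtension g x)).symm
    _ ↔ ∀ x ∈ stoneCechUnit '' bset B, r ≤ stoneCechExtension g x := by
      rw [image_gleasonMap_star, closure_hat]
      exact hclosed.closure_subset_iff
    _ ↔ ∀ s ∈ bset B, r ≤ g s := by
      simp only [Set.forall_mem_image, stoneCechExtension_stoneCechUnit]

variable {μ : 𝔅 → ℝ} {ν : Measure (StoneSpace 𝔅)} [IsFiniteMeasure ν]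

theorem le_setIntegral_of_mem_lowerSums (hν : ∀ B : 𝔅, ν.real (star B) = μ B) {g : S →ᵇ ℝ}
    {D : 𝔅} {x : ℝ} (hx : x ∈ lowerSums μ D g) :
    x ≤ ∫ t in star D, stoneCechExtension g (gleasonMap h𝔅 t) ∂ν := by
  have hint := integrable_stoneCechExtension_gleasonMap h𝔅 ν g
  obtain ⟨N, P, r, hP, hr, rfl⟩ := mem_lowerSums_iff.1 hx
  rw [setIntegral_star_eq_sum hP.disjoint hP.sup_eq_top hint.integrableOn]
  refine Finset.sum_le_sum fun n _ => ?_
  rw [← hν]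
  exact setIntegral_ge_of_const_le_real (measurableSet_star _) (measure_ne_top _ _)
    ((forall_star_le_stoneCechExtension_gleasonMap_iff h𝔅).2 (hr n)) hint.integrableOn

theorem exists_mem_lowerSums_setIntegral_le_add (hμ : IsCredence μ)
    (hν : ∀ B : 𝔅, ν.real (star B) = μ B) (g : S →ᵇ ℝ) (D : 𝔅) {ε : ℝ} (hε : 0 < ε) :
    ∃ x ∈ lowerSums μ D g,
      ∫ t in star D, stoneCechExtension g (gleasonMap h𝔅 t) ∂ν ≤ x + ε := by
  have hint := integrable_stoneCechExtension_gleasonMap h𝔅 ν g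
  obtain ⟨N, P, r, hP, hr⟩ :=
    exists_isPartition_mem_Icc (continuous_stoneCechExtension_gleasonMap h𝔅 g) hε
  have hcell : ∀ n, ∀ t ∈ star (P n ⊓ D),
      stoneCechExtension g (gleasonMap h𝔅 t) ∈ Set.Icc (r n) (r n + ε) := fun n t ht =>
    hr n t (star_subset_star.2 inf_le_left ht)
  refine ⟨∑ n, r n * μ (P n ⊓ D), mem_lowerSums_iff.2 ⟨N, P, r, hP, fun n =>
    (forall_star_le_stoneCechExtension_gleasonMap_iff h𝔅).1 fun t ht => (hcell n t ht).1, rfl⟩, ?_⟩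
  calc ∫ t in star D, stoneCechExtension g (gleasonMap h𝔅 t) ∂ν
      = ∑ n, ∫ t in star (P n ⊓ D), stoneCechExtension g (gleasonMap h𝔅 t) ∂ν :=
        setIntegral_star_eq_sum hP.disjoint hP.sup_eq_top hint.integrableOn
    _ ≤ ∑ n, ∫ _ in star (P n ⊓ D), (r n + ε) ∂ν := Finset.sum_le_sum fun n _ =>
        setIntegral_mono_on hint.integrableOn (integrable_const _) (measurableSet_star _)
          fun t ht => (hcell n t ht).2
    _ = ∑ n, (r n + ε) * μ (P n ⊓ D) := by
        simp only [setIntegral_const, hν, smul_eq_mul, mul_comm]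
    _ = ∑ n, r n * μ (P n ⊓ D) + ε * μ D := by
        simp only [add_mul, Finset.sum_add_distrib, ← Finset.mul_sum, hμ.sum_partition hP]
    _ ≤ ∑ n, r n * μ (P n ⊓ D) + ε := by
        gcongr
        exact mul_le_of_le_one_right hε.le (hμ.le_one D)

theorem integrator_eq_setIntegral (hμ : IsCredence μ)
    (hν : ∀ B : 𝔅, ν.real (star B) = μ B) (g : S →ᵇ ℝ) (D : 𝔅) :
    integrator μ D g = ∫ t in star D, stoneCechExtension g (gleasonMap h𝔅 t) ∂ν := by
  refine (isLUB_integrator hμ D g).unique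
    ⟨fun x hx => le_setIntegral_of_mem_lowerSums h𝔅 hν hx, fun b hb => ?_⟩
  refine le_of_forall_pos_le_add fun ε hε => ?_
  obtain ⟨x, hx, hle⟩ := exists_mem_lowerSums_setIntegral_le_add h𝔅 hμ hν g D hε
  exact hle.trans (add_le_add_left (hb hx) ε)

end Gleason

end CredenceTheory

theorem mainTheorem5_general {S : Type*} [TopologicalSpace S] [T2Space S] [LocallyCompactSpace S]
    (𝔅 : BooleanSubalgebra (Heyting.Regular (Opens S))) (h𝔅 : IsGenerative 𝔅)
    (μ : 𝔅 → ℝ) (hμ : IsCredence μ) :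
    (∃! ν : Measure (StoneSpace 𝔅), IsProbabilityMeasure ν ∧ ν.Regular ∧
      ∀ C : Clopens (StoneSpace 𝔅), ν.real (C : Set (StoneSpace 𝔅)) = stoneCharge μ C) ∧
    ∀ ν : Measure (StoneSpace 𝔅), IsProbabilityMeasure ν →
      (∀ C : Clopens (StoneSpace 𝔅), ν.real (C : Set (StoneSpace 𝔅)) = stoneCharge μ C) →
      ∀ (g : S →ᵇ ℝ) (D : 𝔅),
        IntegrableOn (fun s => stoneCechExtension g (gleasonMap h𝔅 s)) (StoneSpace.star D) ν ∧
        integrator μ D g =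
          ∫ s in StoneSpace.star D, stoneCechExtension g (gleasonMap h𝔅 s) ∂ν := by
  refine ⟨hμ.existsUnique_regular_extension, fun ν _ hν g D => ?_⟩
  have hstar : ∀ B : 𝔅, ν.real (StoneSpace.star B) = μ B := fun B =>
    (hν (StoneSpace.representation B)).trans (stoneCharge_representation μ B)
  exact ⟨(integrable_stoneCechExtension_gleasonMap h𝔅 ν g).integrableOn,
    integrator_eq_setIntegral h𝔅 hμ hstar g D⟩

theorem mainTheorem5 {S : Type*} [TopologicalSpace S] [T2Space S] [LocallyCompactSpace S]
    (𝔅 : BooleanSubalgebra (Heyting.Regular (Opens S))) (h𝔅 : IsGenerative 𝔅)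
    (μ : 𝔅 → ℝ) (hμ : IsCredence μ) :
    (∃! ν : Measure (StoneSpace 𝔅), IsProbabilityMeasure ν ∧ ν.Regular ∧
      ∀ C : Clopens (StoneSpace 𝔅), ν.real (C : Set (StoneSpace 𝔅)) = stoneCharge μ C) ∧
    ∀ ν : Measure (StoneSpace 𝔅), IsProbabilityMeasure ν →
      (∀ C : Clopens (StoneSpace 𝔅), ν.real (C : Set (StoneSpace 𝔅)) = stoneCharge μ C) →
      ∀ g ∈ integrands 𝔅, ∀ D : 𝔅,
        IntegrableOn (fun s => stoneCechExtension g (gleasonMap h𝔅 s)) (StoneSpace.star D) ν ∧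
        integrator μ D g =
          ∫ s in StoneSpace.star D, stoneCechExtension g (gleasonMap h𝔅 s) ∂ν := by
  obtain ⟨hregular, hintegral⟩ := mainTheorem5_general 𝔅 h𝔅 μ hμ
  exact ⟨hregular, fun ν hν hνμ g _ => hintegral ν hν hνμ g⟩
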